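/- **Theorem B.** For a permutation group $G\le \mathrm{Sym}(\Omega)$ on a set $\Omega$ and a positive integer $k$, the $k$-closure $G^{(k)}$ is the group of all permutations $g\in\mathrm{Sym}(\Omega)$ that preserve (setwise) each orbit of $G$ in its componentwise action on the set $\Omega^k$ of ordered $k$-tuples. An abstract group $G$ is called totally $k$-closed if for every set $\Omega$ and every faithful permutation representation of $G$ on $\Omega$, the image of $G$ in $\mathrm{Sym}(\Omega)$ is equal to its $k$-closure. Let $k\ge 1$ be an integer and let $G$ be a finite nilpotent group such that, for every prime $p$ dividing $|G|$, the Sylow $p$-subgroups of $G$ have order at most $p^k$. Then $G$ is totally $k$-closed if and only if, for every prime $p$, $G$ has no subgroup isomorphic to the elementary abelian group $\mathbb{Z}_p^k$. -/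

import Mathlib

open scoped Pointwise

universe u v

/-- The `k`-closure `G^(k)` of a permutation group `G ≤ Sym(Ω)`: the group of all permutations
`g ∈ Sym(Ω)` that leave invariant (as a set) each orbit of `G` in its componentwise action
on the ordered `k`-tuples `Ω^k = (Fin k → Ω)`. -/
def kClosure {Ω : Type v} (k : ℕ) (G : Subgroup (Equiv.Perm Ω)) : Subgroup (Equiv.Perm Ω) :=
  ⨅ x : Fin k → Ω, MulAction.stabilizer (Equiv.Perm Ω) (MulAction.orbit G x)

theorem mem_kClosure_iff {Ω : Type v} (k : ℕ) (G : Subgroup (Equiv.Perm Ω)) (g : Equiv.Perm Ω) :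
    g ∈ kClosure k G ↔
      ∀ x : Fin k → Ω,
        (fun (y : Fin k → Ω) (i : Fin k) => g (y i)) '' {y | ∃ h ∈ G, ∀ i, y i = h (x i)}
          = {y | ∃ h ∈ G, ∀ i, y i = h (x i)} := by
  have key : ∀ x : Fin k → Ω,
      (MulAction.orbit G x) = {y : Fin k → Ω | ∃ h ∈ G, ∀ i, y i = h (x i)} := by
    intro x
    ext y
    constructor
    · rintro ⟨h, rfl⟩
      exact ⟨h, h.2, fun _ => rfl⟩
    · rintro ⟨h, hh, hy⟩
      exact ⟨⟨h, hh⟩, funext fun i => (hy i).symm⟩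
  simp only [kClosure, Subgroup.mem_iInf, MulAction.mem_stabilizer_iff, key]
  rfl

/-- A permutation group `G ≤ Sym(Ω)` is `k`-closed if it is equal to its `k`-closure. -/
def IsKClosed {Ω : Type v} (k : ℕ) (G : Subgroup (Equiv.Perm Ω)) : Prop :=
  kClosure k G = G

/-- An abstract group `G` is totally `k`-closed if, for every set `Ω` and every faithful
permutation representation of `G` on `Ω`, the image of `G` in `Sym(Ω)` is `k`-closed. -/
def IsTotallyKClosed.{w, w'} (k : ℕ) (G : Type w') [Group G] : Prop :=
  ∀ (Ω : Type w) (ρ : G →* Equiv.Perm Ω), Function.Injective ρ → IsKClosed k ρ.range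

/-!
A finite nilpotent group is the product of its Sylow subgroups `P_p`, whose orders are pairwise
coprime, so a subgroup (in particular a point stabilizer) contains the components of each of its
elements.

If no `P_p` is elementary abelian of rank `k`, then in every faithful action each `P_p` has a base
of fewer than `k` points (`exists_base_card_lt`): adding points greedily, every new point divides
the order of the stabilizer by at least `p`, which suffices unless `|P_p| = p ^ k` and all
orbits have length `1` or `p`; but then commutators and `p`-th powers act trivially. Let `σ` be in
the `k`-closure. It agrees with some `h_y ∈ G` on the base of `P_p` together with any
further point `y`, and the base forces the `p`-component of `h_y` to be independent of `y`. The
element `c ∈ G` assembled from these components induces `σ`, since at each `y` every component of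
`h_y⁻¹ c` fixes `y` (`isKClosed_range_of_exists_base`).

Conversely, a subgroup `ℤ_p ^ k` is, by the bound on the order, all of `P_p`. Let it act on `k + 1`
blocks `ℤ_p` by translations through the `k` coordinates and through their sum, and add a faithful
action of the other Sylow subgroups. Any `k` of these `k + 1` functionals are
independent and a `k`-tuple misses a block, so translating a single block lies in the `k`-closure,
but it is not induced by `G` (`not_isTotallyKClosed_of_complement`).
-/

/-! ### The `k`-closure -/

/-- Membership in the `k`-closure is a pointwise condition on tuples: it is enough that `σ` agrees
on every `k`-tuple with some element of `G`, even when `Ω` is infinite. -/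
theorem mem_kClosure_iff_forall_exists {Ω : Type*} {k : ℕ} {G : Subgroup (Equiv.Perm Ω)}
    {σ : Equiv.Perm Ω} :
    σ ∈ kClosure k G ↔ ∀ x : Fin k → Ω, ∃ h ∈ G, ∀ i, σ (x i) = h (x i) := by
  rw [mem_kClosure_iff]
  constructor
  · intro hσ x
    have hx : (fun i => σ (x i)) ∈ {y : Fin k → Ω | ∃ h ∈ G, ∀ i, y i = h (x i)} := by
      rw [← hσ x]
      exact ⟨x, ⟨1, G.one_mem, fun _ => rfl⟩, rfl⟩
    exact hx
  · intro hσ x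
    ext y
    constructor
    · rintro ⟨z, ⟨h, hh, hz⟩, rfl⟩
      obtain ⟨h', hh', hz'⟩ := hσ z
      exact ⟨h' * h, G.mul_mem hh' hh, fun i => by
        rw [Equiv.Perm.mul_apply, ← hz i]; exact hz' i⟩
    · rintro ⟨h, hh, hy⟩
      -- Apply the hypothesis to `σ⁻¹ y`: it yields `h'` in `G` with `σ⁻¹ y = h'⁻¹ y`.
      obtain ⟨h', hh', hz'⟩ := hσ (fun i => σ⁻¹ (y i))
      refine ⟨fun i => σ⁻¹ (y i), ⟨h'⁻¹ * h, G.mul_mem (G.inv_mem hh') hh, fun i => ?_⟩, ?_⟩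
      · have h1 : y i = h' (σ⁻¹ (y i)) := by simpa using hz' i
        rw [Equiv.Perm.mul_apply, ← hy i, Equiv.Perm.eq_inv_iff_eq]
        exact h1.symm
      · funext i
        simp

theorem le_kClosure {Ω : Type*} (k : ℕ) (G : Subgroup (Equiv.Perm Ω)) : G ≤ kClosure k G :=
  fun σ hσ => mem_kClosure_iff_forall_exists.2 fun _ => ⟨σ, hσ, fun _ => rfl⟩

/-- The version of the condition on tuples for sets of at most `k` points. It also covers the case
where `Ω` is empty and there are no tuples. -/
theorem exists_eqOn_finset_of_mem_kClosure {Ω : Type*} {k : ℕ} {G : Subgroup (Equiv.Perm Ω)}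
    {σ : Equiv.Perm Ω} (hσ : σ ∈ kClosure k G) (s : Finset Ω) (hs : s.card ≤ k) :
    ∃ h ∈ G, ∀ x ∈ s, σ x = h x := by
  rcases s.eq_empty_or_nonempty with rfl | ⟨x₀, hx₀⟩
  · exact ⟨1, G.one_mem, by simp⟩
  · let x : Fin k → Ω := fun i => if hi : i.1 < s.card then s.equivFin.symm ⟨i.1, hi⟩ else x₀
    obtain ⟨h, hh, hx⟩ := mem_kClosure_iff_forall_exists.1 hσ x
    refine ⟨h, hh, fun y hy => ?_⟩
    let j := s.equivFin ⟨y, hy⟩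
    have := hx ⟨j.1, j.2.trans_le hs⟩
    simpa [x, j] using this

theorem IsTotallyKClosed.of_mulEquiv {k : ℕ} {G H : Type*} [Group G] [Group H] (e : G ≃* H)
    (hG : IsTotallyKClosed.{v} k G) : IsTotallyKClosed.{v} k H := by
  intro Ω ρ hρ
  have h := hG Ω (ρ.comp e.toMonoidHom) (hρ.comp e.injective)
  rwa [MonoidHom.range_comp, MonoidHom.range_eq_top.2 e.surjective, ← MonoidHom.range_eq_map] at h

theorem isTotallyKClosed_congr {k : ℕ} {G H : Type*} [Group G] [Group H] (e : G ≃* H) :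
    IsTotallyKClosed.{v} k G ↔ IsTotallyKClosed.{v} k H :=
  ⟨fun h => h.of_mulEquiv e, fun h => h.of_mulEquiv e.symm⟩

/-! ### Products of groups of coprime orders -/

/-- The component of `h` in a factor is a power of `h`, by the Chinese remainder theorem. -/
theorem mulSingle_mem_of_coprime_card {ι : Type*} [Finite ι] [DecidableEq ι] {K : ι → Type*}
    [∀ i, Group (K i)] (hK : Pairwise fun i j => (Nat.card (K i)).Coprime (Nat.card (K j)))
    (H : Subgroup (∀ i, K i)) {h : ∀ i, K i} (hh : h ∈ H) (i : ι) :
    Pi.mulSingle i (h i) ∈ H := by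
  have := Fintype.ofFinite ι
  have hco : (Nat.card (K i)).Coprime (∏ j ∈ Finset.univ.erase i, Nat.card (K j)) :=
    Nat.Coprime.prod_right fun j hj => hK (Finset.ne_of_mem_erase hj).symm
  obtain ⟨n, hn₁, hn₀⟩ := Nat.chineseRemainder hco 1 0
  have hpow : h ^ n = Pi.mulSingle i (h i) := by
    funext j
    by_cases hj : j = i
    · subst hj
      rw [Pi.pow_apply, Pi.mulSingle_eq_same]
      conv_rhs => rw [← pow_one (h j)]
      exact pow_eq_pow_iff_modEq.2 (hn₁.of_dvd (orderOf_dvd_natCard _))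
    · rw [Pi.pow_apply, Pi.mulSingle_eq_of_ne hj, ← orderOf_dvd_iff_pow_eq_one]
      exact (orderOf_dvd_natCard (h j)).trans ((Finset.dvd_prod_of_mem (fun j => Nat.card (K j))
        (Finset.mem_erase.2 ⟨hj, Finset.mem_univ j⟩)).trans
        ((Nat.modEq_zero_iff_dvd).1 hn₀))
  rw [← hpow]
  exact H.pow_mem hh n

/-- A permutation group that is a product of groups of pairwise coprime orders is `k`-closed as soon
as each factor has a base of fewer than `k` points. The bases of different factors are unrelated,
so the whole group need not have a base of fewer than `k` points. -/
theorem isKClosed_range_of_exists_base {ι : Type*} [Finite ι] [DecidableEq ι] {K : ι → Type*}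
    [∀ i, Group (K i)] (hK : Pairwise fun i j => (Nat.card (K i)).Coprime (Nat.card (K j)))
    {k : ℕ} (hk : 1 ≤ k) {Ω : Type*} (ρ : (∀ i, K i) →* Equiv.Perm Ω)
    (hbase : ∀ i, ∃ s : Finset Ω, s.card < k ∧
      ∀ a : K i, (∀ x ∈ s, ρ (Pi.mulSingle i a) x = x) → a = 1) :
    IsKClosed k ρ.range := by
  classical
  refine le_antisymm (fun σ hσ => ?_) (le_kClosure _ _)
  -- A subgroup of the product contains the components of its elements; apply this to stabilizers.
  have hcomp : ∀ (s : Set Ω) (g : ∀ i, K i), (∀ x ∈ s, ρ g x = x) →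
      ∀ i, ∀ x ∈ s, ρ (Pi.mulSingle i (g i)) x = x := by
    intro s g hg i
    let H : Subgroup (∀ i, K i) := (fixingSubgroup (Equiv.Perm Ω) s).comap ρ
    have hgH : g ∈ H := by
      simpa [H, mem_fixingSubgroup_iff] using hg
    simpa [H, mem_fixingSubgroup_iff] using mulSingle_mem_of_coprime_card hK H hgH i
  -- For each factor, `σ` is pointwise induced by elements with a common `i`-th component.
  have hc : ∀ i, ∃ c : K i, ∀ y, ∃ g : ∀ i, K i, g i = c ∧ σ y = ρ g y := by
    intro i
    obtain ⟨s, hs, hsb⟩ := hbase i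
    have hy : ∀ y, ∃ g : ∀ i, K i, ∀ x ∈ insert y s, σ x = ρ g x := by
      intro y
      obtain ⟨_, ⟨g, rfl⟩, hg⟩ := exists_eqOn_finset_of_mem_kClosure hσ (insert y s)
        ((Finset.card_insert_le y s).trans hs)
      exact ⟨g, hg⟩
    choose g hg using hy
    -- Two such elements agree on the base `s`, hence have the same `i`-th component.
    have hconst : ∀ y z, g y i = g z i := by
      intro y z
      have h1 := hcomp s ((g z)⁻¹ * g y) (fun x hx => by
        rw [map_mul, map_inv, Equiv.Perm.mul_apply, ← hg y x (Finset.mem_insert_of_mem hx),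
          Equiv.Perm.inv_eq_iff_eq, hg z x (Finset.mem_insert_of_mem hx)]) i
      have h2 := hsb _ h1
      rw [Pi.mul_apply, Pi.inv_apply, inv_mul_eq_one] at h2
      exact h2.symm
    rcases isEmpty_or_nonempty Ω with hΩ | ⟨⟨y₀⟩⟩
    · exact ⟨1, fun y => isEmptyElim y⟩
    · exact ⟨g y₀ i, fun y => ⟨g y, hconst y y₀, hg y y (Finset.mem_insert_self y s)⟩⟩
  choose c hc using hc
  refine ⟨c, Equiv.ext fun y => ?_⟩
  -- Without factors the group is trivial; then a single point already determines the image.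
  rcases isEmpty_or_nonempty ι with hι | ⟨⟨i₀⟩⟩
  · obtain ⟨_, ⟨g, rfl⟩, hg⟩ := exists_eqOn_finset_of_mem_kClosure hσ {y} (by simpa using hk)
    rw [hg y (by simp), Subsingleton.elim c g]
  obtain ⟨g₀, -, hg₀⟩ := hc i₀ y
  -- If `σ y = ρ g y` and `g i = c i`, then `g₀⁻¹ * g` fixes `y`, and so does its `i`-th component,
  -- which is the `i`-th component of `g₀⁻¹ * c`.
  have hmem : g₀⁻¹ * c ∈ (MulAction.stabilizer (Equiv.Perm Ω) y).comap ρ := by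
    refine Subgroup.pi_mem_of_mulSingle_mem _ fun i => ?_
    obtain ⟨g, hgc, hg⟩ := hc i y
    have h1 := hcomp {y} (g₀⁻¹ * g) (by
      rintro x rfl
      rw [map_mul, map_inv, Equiv.Perm.mul_apply, ← hg, Equiv.Perm.inv_eq_iff_eq, hg₀]) i y rfl
    rw [Subgroup.mem_comap, MulAction.mem_stabilizer_iff]
    simpa [hgc] using h1
  have h2 : ρ (g₀⁻¹ * c) y = y := hmem
  rw [map_mul, map_inv, Equiv.Perm.mul_apply, Equiv.Perm.inv_eq_iff_eq] at h2
  rw [h2, hg₀]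

/-! ### Small bases of `p`-groups -/

/-- In a faithful action of a `p`-group, a set whose pointwise stabilizer has order at most `p ^ m`
extends to a base by at most `m` points: each point moved by the stabilizer reduces its order by a
factor of at least `p`. -/
theorem exists_base_extending {p : ℕ} {G Ω : Type*} [Group G] [Finite G] [MulAction G Ω]
    [FaithfulSMul G Ω] [Fact p.Prime] (hG : IsPGroup p G) (m : ℕ) (s : Finset Ω)
    (hs : Nat.card (fixingSubgroup G (s : Set Ω)) ≤ p ^ m) :
    ∃ t : Finset Ω, t.card ≤ s.card + m ∧ fixingSubgroup G (t : Set Ω) = ⊥ := by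
  classical
  induction m generalizing s with
  | zero => exact ⟨s, le_rfl, Subgroup.eq_bot_of_card_le _ (by simpa using hs)⟩
  | succ m ih =>
    by_cases hbot : fixingSubgroup G (s : Set Ω) = ⊥
    · exact ⟨s, by omega, hbot⟩
    obtain ⟨⟨g, hg⟩, hg1⟩ := Subgroup.ne_bot_iff_exists_ne_one.1 hbot
    obtain ⟨x, hx⟩ : ∃ x : Ω, g • x ≠ x := by
      by_contra! h
      exact hg1 (Subtype.ext (FaithfulSMul.eq_of_smul_eq_smul (α := Ω) fun y => by
        simpa using h y))
    have hlt : fixingSubgroup G ((insert x s : Finset Ω) : Set Ω) <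
        fixingSubgroup G (s : Set Ω) := by
      refine lt_of_le_of_ne (fixingSubgroup_antitone G Ω (by simp)) fun heq => hx ?_
      rw [← heq, mem_fixingSubgroup_iff] at hg
      exact hg x (by simp)
    obtain ⟨a, ha⟩ := IsPGroup.iff_card.1 (hG.to_subgroup (fixingSubgroup G (s : Set Ω)))
    obtain ⟨b, hb⟩ := IsPGroup.iff_card.1
      (hG.to_subgroup (fixingSubgroup G ((insert x s : Finset Ω) : Set Ω)))
    have hp : 1 < p := (Fact.out : p.Prime).one_lt
    have hba : b < a := by
      rw [← Nat.pow_lt_pow_iff_right hp, ← ha, ← hb]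
      refine lt_of_not_ge fun hge => hlt.ne (Subgroup.eq_of_le_of_card_ge hlt.le hge)
    have ham : a ≤ m + 1 := (Nat.pow_le_pow_iff_right hp).1 (ha ▸ hs)
    obtain ⟨t, ht, htb⟩ := ih (insert x s)
      (hb ▸ Nat.pow_le_pow_right hp.le (by omega))
    exact ⟨t, ht.trans (by have := Finset.card_insert_le x s; omega), htb⟩

theorem commutator_and_pow_mem_of_index_dvd {p : ℕ} [hp : Fact p.Prime] {G : Type*} [Group G]
    [Finite G] (hG : IsPGroup p G) (N : Subgroup G) (hN : N.index ∣ p) (a b : G) :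
    a * b * (b * a)⁻¹ ∈ N ∧ a ^ p ∈ N := by
  rcases (Nat.dvd_prime hp.out).1 hN with h | h
  · simp [Subgroup.index_eq_one.1 h]
  have hnorm : N.Normal := by
    apply Subgroup.normal_of_index_eq_minFac_card
    obtain ⟨n, hn⟩ := IsPGroup.iff_card.1 hG
    have hn0 : n ≠ 0 := by
      rintro rfl
      have := N.index_dvd_card
      rw [h, hn, pow_zero, Nat.dvd_one] at this
      exact hp.out.ne_one this
    rw [h, hn, hp.out.pow_minFac hn0]
  have hcard : Nat.card (G ⧸ N) = p := h
  have := isCyclic_of_prime_card hcard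
  let := IsCyclic.commGroup (α := G ⧸ N)
  constructor
  · rw [← QuotientGroup.eq_one_iff]
    simp only [QuotientGroup.mk_mul, QuotientGroup.mk_inv]
    rw [mul_inv_eq_one]
    exact mul_comm (a : G ⧸ N) b
  · rw [← QuotientGroup.eq_one_iff, QuotientGroup.mk_pow, ← hcard]
    exact pow_card_eq_one'

theorem nonempty_addEquiv_of_natCard_eq_pow {p k : ℕ} [hp : Fact p.Prime] {V : Type*}
    [AddCommGroup V] [Module (ZMod p) V] (hcard : Nat.card V = p ^ k) :
    Nonempty (V ≃+ (Fin k → ZMod p)) := by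
  have hp1 : 1 < p := hp.out.one_lt
  have : Finite V := Nat.finite_of_card_ne_zero (by rw [hcard]; positivity)
  have : Module.Finite (ZMod p) V := Module.Finite.of_finite
  have hrank : Module.finrank (ZMod p) V = k := by
    have h := Module.natCard_eq_pow_finrank (K := ZMod p) (V := V)
    rw [Nat.card_zmod, hcard] at h
    exact (Nat.pow_right_injective hp1 h).symm
  exact ⟨(Module.finBasisOfFinrankEq (ZMod p) V hrank).equivFun.toAddEquiv⟩

theorem nonempty_mulEquiv_of_commute_of_pow_eq_one {p k : ℕ} [Fact p.Prime] {G : Type*} [Group G]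
    (hcomm : ∀ a b : G, a * b = b * a) (hpow : ∀ a : G, a ^ p = 1) (hcard : Nat.card G = p ^ k) :
    Nonempty (G ≃* Multiplicative (Fin k → ZMod p)) := by
  let : CommGroup G := { ‹Group G› with mul_comm := hcomm }
  let : Module (ZMod p) (Additive G) := AddCommGroup.zmodModule fun x => hpow x.toMul
  exact (nonempty_addEquiv_of_natCard_eq_pow (V := Additive G) hcard).map
    AddEquiv.toMultiplicativeRight

/-- A `p`-group of order at most `p ^ k` other than `ℤ_p ^ k` has a base of fewer than `k` points in
every faithful action. If the order is `p ^ k`, an orbit of length at least `p ^ 2` saves one point;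
without such an orbit every stabilizer is normal of index `1` or `p`, and the group embeds in a
power of `ℤ_p`. -/
theorem exists_base_card_lt {p k : ℕ} (hk : 1 ≤ k) [hp : Fact p.Prime] {G Ω : Type*} [Group G]
    [Finite G] [MulAction G Ω] [FaithfulSMul G Ω] (hG : IsPGroup p G) (hcard : Nat.card G ≤ p ^ k)
    (hne : ¬ Nonempty (G ≃* Multiplicative (Fin k → ZMod p))) :
    ∃ t : Finset Ω, t.card < k ∧ fixingSubgroup G (t : Set Ω) = ⊥ := by
  obtain ⟨n, hn⟩ := IsPGroup.iff_card.1 hG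
  have hp1 : 1 < p := hp.out.one_lt
  have hnk : n ≤ k := (Nat.pow_le_pow_iff_right hp1).1 (hn ▸ hcard)
  rcases hnk.lt_or_eq with hlt | rfl
  · obtain ⟨t, ht, htb⟩ := exists_base_extending (Ω := Ω) hG n ∅
      ((Nat.card_le_card_of_injective _ Subtype.val_injective).trans hn.le)
    exact ⟨t, by simpa using ht.trans_lt (by simpa using hlt), htb⟩
  by_cases hx : ∃ x : Ω, ¬ (MulAction.stabilizer G x).index ∣ p
  · obtain ⟨x, hx⟩ := hx
    obtain ⟨a, ha⟩ := hG.index (MulAction.stabilizer G x)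
    obtain ⟨b, hb⟩ := IsPGroup.iff_card.1 (hG.to_subgroup (MulAction.stabilizer G x))
    have ha2 : 2 ≤ a := by
      by_contra! h
      exact hx (ha ▸ (pow_dvd_pow p (by omega : a ≤ 1)).trans (pow_one p).dvd)
    have hab : b + a = n := by
      have h := (MulAction.stabilizer G x).card_mul_index
      rw [ha, hb, hn, ← pow_add] at h
      exact Nat.pow_right_injective hp1 h
    obtain ⟨t, ht, htb⟩ := exists_base_extending (Ω := Ω) hG b {x} (by
      rw [Finset.coe_singleton, ← hb]
      exact Nat.card_le_card_of_injective (Subgroup.inclusion fun g hg => by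
        simpa [mem_fixingSubgroup_iff] using hg) (Subgroup.inclusion_injective _))
    exact ⟨t, by simp at ht; omega, htb⟩
  · push Not at hx
    have key := fun (a b : G) (x : Ω) => commutator_and_pow_mem_of_index_dvd hG _ (hx x) a b
    refine absurd (nonempty_mulEquiv_of_commute_of_pow_eq_one (fun a b => ?_) (fun a => ?_) hn) hne
    · rw [← mul_inv_eq_one]
      exact FaithfulSMul.eq_of_smul_eq_smul (α := Ω) fun x => by simpa using (key a b x).1
    · exact FaithfulSMul.eq_of_smul_eq_smul (α := Ω) fun x => by simpa using (key a a x).2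

/-! ### A faithful representation that is not `k`-closed -/

/-- The action of `Option κ → A` on `Option κ × A` in which `w` translates the block `{o} × A`
by `w o`. -/
def blockTranslation (κ A : Type*) [AddGroup A] :
    Multiplicative (Option κ → A) →* Equiv.Perm (Option κ × A) where
  toFun w := Equiv.prodShear (Equiv.refl _) fun o => Equiv.addLeft (w.toAdd o)
  map_one' := by ext ⟨o, a⟩ <;> simp
  map_mul' w w' := by ext ⟨o, a⟩ <;> simp

/-- The coordinates of `v`, together with their sum as an additional coordinate at `none`. -/
def coordinatesAndSum (κ A : Type*) [Fintype κ] [AddCommGroup A] : (κ → A) →+ (Option κ → A) where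
  toFun v o := o.elim (∑ i, v i) v
  map_zero' := by ext (_ | i) <;> simp
  map_add' v v' := by ext (_ | i) <;> simp [Finset.sum_add_distrib]

@[simp] theorem coordinatesAndSum_none {κ A : Type*} [Fintype κ] [AddCommGroup A] (v : κ → A) :
    coordinatesAndSum κ A v none = ∑ i, v i := rfl

@[simp] theorem coordinatesAndSum_some {κ A : Type*} [Fintype κ] [AddCommGroup A] (v : κ → A)
    (i : κ) : coordinatesAndSum κ A v (some i) = v i := rfl

/-- Any `|κ|` of the `|κ| + 1` functionals in `coordinatesAndSum` take arbitrary prescribed values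
simultaneously. -/
theorem exists_coordinatesAndSum_eq {κ A : Type*} [Fintype κ] [AddCommGroup A]
    (w : Option κ → A) (o : Option κ) :
    ∃ v : κ → A, ∀ o', o' ≠ o → coordinatesAndSum κ A v o' = w o' := by
  classical
  rcases o with _ | j
  · refine ⟨fun i => w (some i), ?_⟩
    rintro (_ | i) hi
    · exact absurd rfl hi
    · rfl
  · refine ⟨Function.update (fun i => w (some i)) j
      (w none - ∑ i ∈ Finset.univ.erase j, w (some i)), ?_⟩
    rintro (_ | i) hi
    · rw [coordinatesAndSum_none, ← Finset.add_sum_erase _ _ (Finset.mem_univ j),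
        Function.update_self, Finset.sum_congr rfl fun i hi =>
          Function.update_of_ne (Finset.ne_of_mem_erase hi) _ _, sub_add_cancel]
    · rw [coordinatesAndSum_some, Function.update_of_ne fun h => hi (by rw [h])]

/-- If `φ` restricts to an isomorphism from the kernel of `f` onto `ℤ_p ^ k`, then the action `f`
together with the `k + 1` blocks on which `G` translates by the coordinates of `φ` and by their sum
is faithful, but not `k`-closed. -/
theorem not_isTotallyKClosed_of_complement {k p : ℕ} [hp : Fact p.Prime] {G : Type*} [Group G]
    {A : Type v} (f : G →* Equiv.Perm A) (φ : G →* Multiplicative (Fin k → ZMod p))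
    (hsurj : ∀ v, ∃ g, f g = 1 ∧ φ g = v) (hinj : ∀ g, f g = 1 → φ g = 1 → g = 1) :
    ¬ IsTotallyKClosed.{v} k G := by
  classical
  intro hG
  let B := Option (Fin k) × ZMod p
  let T : Multiplicative (Option (Fin k) → ZMod p) →* Equiv.Perm (ULift.{v} B) :=
    (Equiv.ulift.symm.permCongrHom : Equiv.Perm B ≃* Equiv.Perm (ULift.{v} B)).toMonoidHom.comp
      (blockTranslation (Fin k) (ZMod p))
  have hT : ∀ w x, T w x = ULift.up (x.down.1, w.toAdd x.down.1 + x.down.2) := fun _ _ => rfl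
  let χ : G →* Multiplicative (Option (Fin k) → ZMod p) :=
    (AddMonoidHom.toMultiplicative (coordinatesAndSum (Fin k) (ZMod p))).comp φ
  have hχ : ∀ g, (χ g).toAdd = coordinatesAndSum (Fin k) (ZMod p) (φ g).toAdd := fun _ => rfl
  let ρ : G →* Equiv.Perm (A ⊕ ULift.{v} B) :=
    (Equiv.Perm.sumCongrHom A (ULift.{v} B)).comp (f.prod (T.comp χ))
  have hρl : ∀ g a, ρ g (Sum.inl a) = Sum.inl (f g a) := fun _ _ => rfl
  have hρr : ∀ g b, ρ g (Sum.inr b) = Sum.inr (T (χ g) b) := fun _ _ => rfl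
  -- A block translation determines its vector: evaluate at the zero of each block.
  have hTw : ∀ g w, (∀ b, ρ g (Sum.inr b) = Sum.inr (T w b)) → (χ g).toAdd = w.toAdd := by
    intro g w h
    funext o
    have h1 := h (ULift.up (o, 0))
    rw [hρr, hT, hT] at h1
    simpa using h1
  have hρ : Function.Injective ρ := by
    rw [injective_iff_map_eq_one]
    intro g hg
    refine hinj g (Equiv.ext fun a => Sum.inl_injective (β := ULift.{v} B) ?_) ?_
    · rw [← hρl, hg]; rfl
    · have h := hTw g 1 fun b => by rw [hg, map_one]; rfl
      refine Multiplicative.toAdd.injective (funext fun i => ?_)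
      rw [hχ] at h
      exact congrFun h (some i)
  -- Translating the block of the sum alone is locally, but not globally, induced by `G`.
  let w : Option (Fin k) → ZMod p := Pi.single none 1
  let σ : Equiv.Perm (A ⊕ ULift.{v} B) := Equiv.Perm.sumCongr 1 (T (Multiplicative.ofAdd w))
  have hσ : σ ∈ kClosure k ρ.range := by
    rw [mem_kClosure_iff_forall_exists]
    intro x
    -- There are `k + 1` blocks, so the tuple misses one of them.
    obtain ⟨o, ho⟩ : ∃ o, ∀ i, Sum.elim (fun _ => none) (fun b => b.down.1) (x i) ≠ o := by
      by_contra! h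
      have := Fintype.card_le_of_surjective _ h
      simp at this
    obtain ⟨v, hv⟩ := exists_coordinatesAndSum_eq w o
    obtain ⟨g, hg1, hgv⟩ := hsurj (Multiplicative.ofAdd v)
    refine ⟨ρ g, ⟨g, rfl⟩, fun i => ?_⟩
    have hoi := ho i
    rcases hxi : x i with a | b
    · rw [hρl, hg1]; rfl
    · rw [hxi] at hoi
      rw [hρr]
      change Sum.inr (T _ b) = _
      rw [hT, hT, hχ, hgv, toAdd_ofAdd, toAdd_ofAdd, hv b.down.1 hoi]
  rw [hG _ ρ hρ] at hσ
  obtain ⟨g, hg⟩ := hσ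
  have h := hTw g (Multiplicative.ofAdd w) fun b => by rw [hg]; rfl
  rw [hχ, toAdd_ofAdd] at h
  have hv : ∀ i, (φ g).toAdd i = 0 := fun i =>
    (congrFun h (some i)).trans (Pi.single_eq_of_ne (Option.some_ne_none i) 1)
  have h0 := congrFun h none
  rw [coordinatesAndSum_none, Finset.sum_eq_zero fun i _ => hv i] at h0
  exact zero_ne_one (h0.trans (Pi.single_eq_same none 1))

theorem not_isTotallyKClosed_pi {ι : Type*} [DecidableEq ι] {K : ι → Type*}
    [∀ i, Group (K i)] [Finite (∀ i, K i)] {k p : ℕ} [Fact p.Prime] (i : ι)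
    (e : K i ≃* Multiplicative (Fin k → ZMod p)) : ¬ IsTotallyKClosed.{v} k (∀ i, K i) := by
  -- The complement of the factor `K i` acts regularly on itself, moved to the universe `v`.
  let C := ∀ j : {j // j ≠ i}, K j
  let r : (∀ j, K j) →* C := MonoidHom.pi fun j => Pi.evalMonoidHom K j
  have hr : ∀ g, r g = 1 ↔ ∀ j, j ≠ i → g j = 1 := fun g =>
    ⟨fun h j hj => congrFun h ⟨j, hj⟩, fun h => funext fun j => h j.1 j.2⟩
  have : Finite C := Finite.of_surjective r fun c =>
    ⟨fun j => if hj : j ≠ i then c ⟨j, hj⟩ else 1, funext fun j => dif_pos j.2⟩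
  obtain ⟨n, ⟨E⟩⟩ := Finite.exists_equiv_fin C
  let f : (∀ j, K j) →* Equiv.Perm (ULift.{v} (Fin n)) :=
    ((E.trans Equiv.ulift.symm).permCongrHom.toMonoidHom.comp (MulAction.toPermHom C C)).comp r
  have hf : ∀ g, f g = 1 ↔ r g = 1 := fun g => by
    change (E.trans Equiv.ulift.symm).permCongrHom (MulAction.toPermHom C C (r g)) = 1 ↔ _
    rw [EmbeddingLike.map_eq_one_iff]
    exact map_eq_one_iff _ MulAction.toPerm_injective
  refine not_isTotallyKClosed_of_complement f (e.toMonoidHom.comp (Pi.evalMonoidHom K i))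
    (fun v => ⟨Pi.mulSingle i (e.symm v), ?_, by simp⟩) fun g hg hφ => ?_
  · rw [hf, hr]
    exact fun j hj => Pi.mulSingle_eq_of_ne hj _
  · rw [hf, hr] at hg
    funext j
    by_cases hj : j = i
    · subst hj
      simpa using hφ
    · exact hg j hj

/-! ### Nilpotent groups -/

theorem isTotallyKClosed_pi {k : ℕ} (hk : 1 ≤ k) {ι : Type*} [Finite ι] [DecidableEq ι]
    {K : ι → Type*} [∀ i, Group (K i)] [∀ i, Finite (K i)] {p : ι → ℕ}
    (hp : ∀ i, (p i).Prime) (hp_inj : Function.Injective p) (hK : ∀ i, IsPGroup (p i) (K i))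
    (hcard : ∀ i, Nat.card (K i) ≤ p i ^ k)
    (hne : ∀ i, ¬ Nonempty (K i ≃* Multiplicative (Fin k → ZMod (p i)))) :
    IsTotallyKClosed.{v} k (∀ i, K i) := by
  intro Ω ρ hρ
  refine isKClosed_range_of_exists_base (fun i j hij => ?_) hk ρ fun i => ?_
  · have := Fact.mk (hp i)
    have := Fact.mk (hp j)
    obtain ⟨m, hm⟩ := IsPGroup.iff_card.1 (hK i)
    obtain ⟨n, hn⟩ := IsPGroup.iff_card.1 (hK j)
    change (Nat.card (K i)).Coprime (Nat.card (K j))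
    rw [hm, hn]
    exact Nat.Coprime.pow _ _ ((Nat.coprime_primes (hp i) (hp j)).2 (hp_inj.ne hij))
  · have := Fact.mk (hp i)
    let ρi : K i →* Equiv.Perm Ω := ρ.comp (MonoidHom.mulSingle K i)
    have hρi : Function.Injective ρi := hρ.comp (Pi.mulSingle_injective i)
    let : MulAction (K i) Ω := MulAction.compHom Ω ρi
    have hsmul : ∀ (a : K i) (x : Ω), a • x = ρ (Pi.mulSingle i a) x := fun _ _ => rfl
    have : FaithfulSMul (K i) Ω := ⟨fun h => hρi (Equiv.ext h)⟩
    obtain ⟨t, ht, htb⟩ := exists_base_card_lt (Ω := Ω) hk (hK i) (hcard i) (hne i)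
    refine ⟨t, ht, fun a ha => ?_⟩
    rw [← Subgroup.mem_bot, ← htb, mem_fixingSubgroup_iff]
    exact ha

theorem theoremB {G : Type u} [Group G] [Finite G] [Group.IsNilpotent G] (k : ℕ) (hk : 1 ≤ k)
    (hG : ∀ p : ℕ, p.Prime → p ∣ Nat.card G → ∀ P : Sylow p G, Nat.card P ≤ p ^ k) :
    IsTotallyKClosed.{v} k G ↔
      ∀ p : ℕ, p.Prime →
        ¬ ∃ H : Subgroup G, Nonempty (H ≃* Multiplicative (Fin k → ZMod p)) := by
  classical
  have hprime : ∀ p : (Nat.card G).primeFactors, p.1.Prime := fun p =>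
    Nat.prime_of_mem_primeFactors p.2
  have hdvd : ∀ p : (Nat.card G).primeFactors, p.1 ∣ Nat.card G := fun p =>
    Nat.dvd_of_mem_primeFactors p.2
  let P : ∀ p : (Nat.card G).primeFactors, Sylow p G := default
  -- A normal Sylow subgroup is the only one for its prime.
  have hunique : ∀ (p : (Nat.card G).primeFactors) (Q : Sylow p G), Q = P p := fun p Q =>
    have := Fact.mk (hprime p)
    have := Sylow.unique_of_normal (P p) inferInstance
    Subsingleton.elim _ _
  let e : (∀ p, P p) ≃* G :=
    (MulEquiv.piCongrRight fun p : (Nat.card G).primeFactors =>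
      let : Unique (Sylow p G) := ⟨⟨P p⟩, hunique p⟩
      (MulEquiv.piUnique fun Q : Sylow p G => Q).symm).trans
      (Sylow.directProductOfNormal fun Q => inferInstance)
  rw [← isTotallyKClosed_congr e]
  constructor
  · rintro hclosed p hp ⟨H, ⟨eH⟩⟩
    have := Fact.mk hp
    have hHcard : Nat.card H = p ^ k := by
      rw [Nat.card_congr eH.toEquiv]
      simp [Nat.card_eq_fintype_card]
    have hpG : p ∣ Nat.card G :=
      (dvd_pow_self p (by omega)).trans (hHcard ▸ H.card_subgroup_dvd_card)
    let i : (Nat.card G).primeFactors := ⟨p, hp.mem_primeFactors hpG Nat.card_pos.ne'⟩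
    obtain ⟨Q, hQ⟩ := (IsPGroup.of_card hHcard).exists_le_sylow
    have hHP : H = P i := by
      rw [← hunique i Q]
      exact Subgroup.eq_of_le_of_card_ge hQ (hHcard ▸ hG p hp hpG Q)
    exact not_isTotallyKClosed_pi i ((MulEquiv.subgroupCongr hHP.symm).trans eH) hclosed
  · intro h
    exact isTotallyKClosed_pi hk hprime Subtype.val_injective (fun i => (P i).isPGroup')
      (fun i => hG i (hprime i) (hdvd i) (P i)) fun i hi => h i (hprime i) ⟨P i, hi⟩
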